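/- Let $\ell\ge 0$ be an integer, let $0<q<1$ and let $\lambda=(\lambda_1,\dots,\lambda_{\ell+1})\in\mathbb{R}^{\ell+1}$. For an integer $n\ge 0$ put $(n)_q!=(1-q)(1-q^2)\cdots(1-q^n)$, with $(0)_q!=1$. For $\underline p=(p_1,\dots,p_{\ell+1})\in\mathbb{Z}^{\ell+1}$ let $\mathcal P(\underline p)$ be the finite set of Gelfand–Zetlin patterns with top row $\underline p$, that is, of arrays of integers $(p_{k,i})_{1\le i\le k\le \ell+1}$ with $p_{\ell+1,i}=p_i$ for $1\le i\le \ell+1$ and $p_{k+1,i}\le p_{k,i}\le p_{k+1,i+1}$ for $1\le i\le k\le \ell$. Define $\Psi_\lambda:\mathbb{Z}^{\ell+1}\to\mathbb{R}$ by $$ \Psi_\lambda(\underline p)=\sum_{(p_{k,i})\in\mathcal P(\underline p)}\ \prod_{k=1}^{\ell+1} q^{\lambda_k\left(\sum_{i=1}^{k}p_{k,i}-\sum_{i=1}^{k-1}p_{k-1,i}\right)}\cdot \frac{\prod_{k=2}^{\ell}\prod_{i=1}^{k-1}(p_{k,i+1}-p_{k,i})_q!}{\prod_{k=1}^{\ell}\prod_{i=1}^{k}(p_{k,i}-p_{k+1,i})_q!\,(p_{k+1,i+1}-p_{k,i})_q!}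 $$ if $p_1\le p_2\le\dots\le p_{\ell+1}$, and $\Psi_\lambda(\underline p)=0$ otherwise. For $1\le r\le \ell+1$ let $\mathcal H_r$ be the lattice $q$-deformed $\mathfrak{gl}_{\ell+1}$-Toda Hamiltonian acting on functions on $\mathbb{Z}^{\ell+1}$, $$ \mathcal H_r=\sum_{I=\{i_1<\dots<i_r\}\subset\{1,\dots,\ell+1\}} X_{i_1}^{1-\delta_{i_1,1}}X_{i_2}^{1-\delta_{i_2-i_1,1}}\cdots X_{i_r}^{1-\delta_{i_r-i_{r-1},1}}\;T_{i_1}\cdots T_{i_r}, $$ where $\delta$ is the Kronecker delta, $X_1=1$, $X_i$ for $2\le i\le \ell+1$ is multiplication by $X_i(\underline p)=1-q^{p_i-p_{i-1}+1}$, and $(T_if)(\underline p)=f(p_1,\dots,p_{i-1},p_i+1,p_{i+1},\dots,p_{\ell+1})$. Then $\Psi_\lambda$ is a common eigenfunction of $\mathcal H_1,\dots,\mathcal H_{\ell+1}$: it is not identically zero, and for every $r=1,\dots,\ell+1$ and every $\underline p\in\mathbb{Z}^{\ell+1}$ $$ (\mathcal H_r\Psi_\lambda)(\underline p)=\Big(\sum_{I\subset\{1,\dots,\ell+1\},\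 |I|=r}\ \prod_{i\in I}q^{\lambda_i}\Big)\,\Psi_\lambda(\underline p). $$ -/

import Mathlib

namespace QToda

/-- The `q`-factorial `(n)_q! = (1 - q)(1 - q^2)...(1 - q^n)`, for an integer `n ≥ 0`.
It is only ever evaluated below at nonnegative integers. -/
noncomputable def qFactorial (q : ℝ) (n : ℤ) : ℝ :=
  ∏ j ∈ Finset.range n.toNat, (1 - q ^ (j + 1))

/-! ### The lattice `q`-deformed `gl_{ℓ+1}`-Toda Hamiltonians

Points of the lattice `ℤ^{ℓ+1}` are functions `p : Fin (ℓ + 1) → ℤ`; the coordinate with index `i`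
(counted from `0`) is the coordinate number `i + 1` in the usual numbering. -/

/-- The factor `X_i(p)`: it is `1` for the first index, and `1 - q^{p_i - p_{i-1} + 1}` for
every other index `i`. -/
noncomputable def todaX {ℓ : ℕ} (q : ℝ) (p : Fin (ℓ + 1) → ℤ) (i : Fin (ℓ + 1)) : ℝ :=
  Fin.cases (motive := fun _ => ℝ) 1 (fun j => 1 - q ^ (p j.succ - p j.castSucc + 1)) i

/-- The shift `T_I = ∏_{i ∈ I} T_i`, where `T_i` increases the `i`-th coordinate by one. -/
def shift {ℓ : ℕ} (I : Finset (Fin (ℓ + 1))) (f : (Fin (ℓ + 1) → ℤ) → ℝ) :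
    (Fin (ℓ + 1) → ℤ) → ℝ :=
  fun p => f (fun k => p k + if k ∈ I then 1 else 0)

/-- The coefficient `∏_k X_{i_k}^{1 - δ_{i_k - i_{k-1}, 1}}` of `T_I` for
`I = {i_1 < i_2 < ...}`: the factor of `i ∈ I` is omitted exactly when `i - 1 ∈ I`
(that of the first index is `1` anyway). -/
noncomputable def todaCoeff {ℓ : ℕ} (q : ℝ) (I : Finset (Fin (ℓ + 1)))
    (p : Fin (ℓ + 1) → ℤ) : ℝ :=
  ∏ i ∈ I, if ∃ j ∈ I, (j : ℕ) + 1 = (i : ℕ) then 1 else todaX q p i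

/-- The `r`-th Hamiltonian `H_r = ∑_{|I| = r} (∏_k X_{i_k}^{1 - δ_{i_k - i_{k-1}, 1}}) T_I`. -/
noncomputable def todaHamiltonian {ℓ : ℕ} (q : ℝ) (r : ℕ) (f : (Fin (ℓ + 1) → ℤ) → ℝ) :
    (Fin (ℓ + 1) → ℤ) → ℝ :=
  fun p => ∑ I ∈ Finset.powersetCard r (Finset.univ : Finset (Fin (ℓ + 1))),
    todaCoeff q I p * shift I f p

/-! ### Gelfand-Zetlin patterns and the function `Ψ` -/

/-- Triangular arrays of integers: the row with index `k` (counted from `0`) has `k + 1`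
entries, and there are `ℓ + 1` rows. -/
abbrev TriangularArray (ℓ : ℕ) : Type := (k : Fin (ℓ + 1)) → Fin ((k : ℕ) + 1) → ℤ

/-- Gelfand-Zetlin patterns with top row `p`: triangular arrays with last row `p`
satisfying `P_{k+1,j} ≤ P_{k,j} ≤ P_{k+1,j+1}`. -/
def gzPatterns {ℓ : ℕ} (p : Fin (ℓ + 1) → ℤ) : Set (TriangularArray ℓ) :=
  {P | P (Fin.last ℓ) = p ∧
    ∀ (k : Fin ℓ) (j : Fin ((k : ℕ) + 1)),
      P k.succ j.castSucc ≤ P k.castSucc j ∧ P k.castSucc j ≤ P k.succ j.succ}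

theorem gzPatterns_finite {ℓ : ℕ} (p : Fin (ℓ + 1) → ℤ) : (gzPatterns p).Finite := by
  classical
  obtain ⟨a, ha⟩ := (Set.finite_range p).bddBelow
  obtain ⟨b, hb⟩ := (Set.finite_range p).bddAbove
  refine Set.Finite.subset
    (Set.finite_Icc (fun _ _ => a : TriangularArray ℓ) (fun _ _ => b)) ?_
  rintro P ⟨hP, hI⟩
  have key : ∀ (k : Fin (ℓ + 1)) (j : Fin ((k : ℕ) + 1)), a ≤ P k j ∧ P k j ≤ b := by
    intro k
    induction k using Fin.reverseInduction with
    | last =>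
      intro j
      rw [hP]
      exact ⟨ha ⟨j, rfl⟩, hb ⟨j, rfl⟩⟩
    | cast k ih =>
      intro j
      exact ⟨(ih j.castSucc).1.trans (hI k j).1, (hI k j).2.trans (ih j.succ).2⟩
  exact ⟨fun k j => (key k j).1, fun k j => (key k j).2⟩

/-- The sum of the row below the row `k` (below the one-entry row there is the empty row). -/
def prevRowSum {ℓ : ℕ} (P : TriangularArray ℓ) (k : Fin (ℓ + 1)) : ℤ :=
  Fin.cases (motive := fun _ => ℤ) 0 (fun j => ∑ i, P j.castSucc i) k

/-- The summand attached to a pattern `P`. The index `k` runs over the rows other than the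
top row in the two products of `q`-factorials, and over all rows in the first product. -/
noncomputable def gzWeight {ℓ : ℕ} (q : ℝ) (lam : Fin (ℓ + 1) → ℝ) (P : TriangularArray ℓ) : ℝ :=
  (∏ k : Fin (ℓ + 1), q ^ (lam k * (((∑ i, P k i) - prevRowSum P k : ℤ) : ℝ))) *
    ((∏ k : Fin ℓ, ∏ i : Fin (k : ℕ),
        qFactorial q (P k.castSucc i.succ - P k.castSucc i.castSucc)) /
      (∏ k : Fin ℓ, ∏ i : Fin ((k : ℕ) + 1),
        qFactorial q (P k.castSucc i - P k.succ i.castSucc) *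
          qFactorial q (P k.succ i.succ - P k.castSucc i)))

open Classical in
/-- The function `Ψ_λ` on `ℤ^{ℓ+1}`: the sum over Gelfand-Zetlin patterns with top row `p`
if `p_1 ≤ ... ≤ p_{ℓ+1}`, and zero otherwise. -/
noncomputable def qWhittaker {ℓ : ℕ} (q : ℝ) (lam : Fin (ℓ + 1) → ℝ)
    (p : Fin (ℓ + 1) → ℤ) : ℝ :=
  if Monotone p then ∑ P ∈ (gzPatterns_finite p).toFinset, gzWeight q lam P else 0

end QToda

/-!
Let `H(t) = ∑ t ^ r H_r`. Splitting off the top row of a Gelfand-Zetlin pattern writes `Ψ` in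
`ℓ + 2` variables as the transform of `Ψ` in `ℓ + 1` variables under a kernel `Q(p, p')`, and `Q`
intertwines the two Hamiltonians: with `z = q ^ λ_{ℓ+2}`, the operator `H(t)` acting on `p` equals
`1 + t z` times the adjoint of `H(t)` acting on `p'`. By induction `H(t)` multiplies `Ψ` by
`∏ (1 + t q ^ λ_i)`, and the coefficients of `t ^ r` give the eigenvalues.

After division by the common factors of the kernels, the intertwining relation compares two
partition functions of a one-dimensional lattice whose sites are occupied or empty (they belong to
the shifted subset or not). Both are products of `2 × 2` transfer matrices, and an explicit matrix
exchanges the transfer matrices of one side with those of the other, step by step.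
-/

namespace QToda

open Finset Matrix

theorem sum_powersetCard_eq_of_sum_pow_card_mul_eq {α R : Type*} [Fintype α] [CommRing R]
    [IsDomain R] [Infinite R] {g h : Finset α → R}
    (hgh : ∀ t : R, ∑ I, t ^ #I * g I = ∑ I, t ^ #I * h I) (r : ℕ) :
    ∑ I ∈ powersetCard r univ, g I = ∑ I ∈ powersetCard r univ, h I := by
  have hpoly : ∑ I, Polynomial.C (g I) * Polynomial.X ^ #I =
      ∑ I, Polynomial.C (h I) * Polynomial.X ^ #I :=
    Polynomial.funext fun t => by
      simpa [Polynomial.eval_finsetSum, mul_comm (_ ^ _)] using hgh t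
  have hcoeff (f : Finset α → R) : (∑ I, Polynomial.C (f I) * Polynomial.X ^ #I).coeff r =
      ∑ I ∈ powersetCard r univ, f I := by
    rw [Polynomial.finsetSum_coeff, powersetCard_eq_filter, powerset_univ, sum_filter]
    simp only [Polynomial.coeff_C_mul_X_pow, eq_comm]
  rw [← hcoeff, ← hcoeff, hpoly]

section TransferMatrix

variable {R σ τ : Type*}

/-- The weight of the path `ε 0, ε 1, …, ε n` of states, with initial weights `v` and with the
weights `A i` for the `i`-th step. Its sum over all paths is the product of `v` with the matrices
`A i`, summed over the entries. -/
def pathWeight [CommSemiring R] {n : ℕ} (v : σ → R) (A : Fin n → Matrix σ σ R)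
    (ε : Fin (n + 1) → σ) : R :=
  v (ε 0) * ∏ i, A i (ε i.castSucc) (ε i.succ)

theorem sum_pathWeight_zero [CommSemiring R] [Fintype σ] (v : σ → R) (A : Fin 0 → Matrix σ σ R) :
    ∑ ε, pathWeight v A ε = v ⬝ᵥ 1 := by
  rw [← (Equiv.funUnique (Fin 1) σ).symm.sum_comp]
  simp [pathWeight, dotProduct]

theorem sum_pathWeight_succ [CommSemiring R] [Fintype σ] {n : ℕ} (v : σ → R)
    (A : Fin (n + 1) → Matrix σ σ R) :
    ∑ ε, pathWeight v A ε = ∑ ε, pathWeight (v ᵥ* A 0) (Fin.tail A) ε := by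
  rw [← (Fin.consEquiv fun _ => σ).sum_comp, Fintype.sum_prod_type_right]
  refine sum_congr rfl fun ε _ => ?_
  simp only [pathWeight, Fin.consEquiv_apply, Fin.prod_univ_succ, Fin.cons_zero, Fin.cons_succ,
    Fin.castSucc_zero, Fin.castSucc_succ, vecMul, dotProduct, Fin.tail, sum_mul, mul_assoc]

theorem sum_pathWeight_of_intertwining [CommSemiring R] [Fintype σ] [Fintype τ] {n : ℕ}
    {A : Fin n → Matrix τ τ R} {B : Fin n → Matrix σ σ R} {M : Fin (n + 1) → Matrix σ τ R}
    (hMA : ∀ i, M i.castSucc * A i = B i * M i.succ) {c : R}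
    (hM : M (Fin.last n) *ᵥ 1 = fun _ => c) (v : σ → R) :
    ∑ ε, pathWeight (v ᵥ* M 0) A ε = c * ∑ ε, pathWeight v B ε := by
  induction n generalizing v with
  | zero =>
    rw [sum_pathWeight_zero, sum_pathWeight_zero, ← dotProduct_mulVec]
    exact (congrArg (v ⬝ᵥ ·) hM).trans (by simp [dotProduct, mul_sum, mul_comm])
  | succ n ih =>
    rw [sum_pathWeight_succ, sum_pathWeight_succ, vecMul_vecMul, ← Fin.castSucc_zero, hMA,
      ← vecMul_vecMul]
    exact ih (M := Fin.tail M) (fun i => hMA i.succ) hM _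

theorem sum_finset_eq_sum_bool [AddCommMonoid R] [Fintype σ] [DecidableEq σ] (f : (σ → Bool) → R) :
    ∑ I : Finset σ, f (fun i => i ∈ I) = ∑ ε, f ε :=
  sum_bij' (fun I _ i => decide (i ∈ I)) (fun ε _ => ({i | ε i} : Finset σ)) (by simp) (by simp)
    (by simp) (by simp) (by simp)

end TransferMatrix

section TodaEdges

variable {R : Type*} [CommRing R]

/-- The factor by which the edge between the sites `i` and `i + 1` of `p` enters the action of
`H_I` on the interlacing kernel at `(p, p')`. Here `x` and `y` say whether `i` and `i + 1` belong
to `I`, and `a = q ^ (p'_i - p_i)`, `b = q ^ (p_{i+1} - p'_i + 1)`. -/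
def upperEdge (a b : R) (x y : Bool) : R :=
  (if y ∧ ¬x then 1 - a * b else 1) * ((if x then 1 - a else 1) * (if y then 1 else 1 - b))

/-- The transfer matrix of `upperEdge`, in which an occupied right end of the edge has the
additional weight `s`. -/
def upperStep (s a b : R) : Matrix Bool Bool R :=
  .of fun x y => (if y then s else 1) * upperEdge a b x y

/-- The factor by which a site of `p'` enters the adjoint action of `H_J` on the interlacing
kernel at `(p, p')`. Here `x` says whether the site belongs to `J`, and `a`, `b` are as for
`upperEdge`. -/
def lowerSite (a b : R) (x : Bool) : R := if x then 1 - a else 1 - b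

/-- The factor by which the edge between two neighbouring sites of `p'` enters the adjoint action
of `H_J` on the interlacing kernel. Here `b` belongs to the left site and `a` to the right one. -/
def lowerEdge (b a : R) (x y : Bool) : R := if x ∧ ¬y then 1 - b * a else 1

/-- The transfer matrix of `lowerSite` and `lowerEdge`, in which an occupied right end of the edge
has the additional weight `s`. -/
def lowerStep (s b a' b' : R) : Matrix Bool Bool R :=
  .of fun x y => (if y then s else 1) * (lowerSite a' b' y * lowerEdge b a' x y)

/-- The matrix which intertwines `upperStep` and `lowerStep`. -/
def intertwiner (s b : R) : Matrix Bool Bool R :=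
  .of fun x y => if y then (if x then s + b else s) else (if x then 1 - b else 1)

theorem intertwiner_mul_upperStep (s b a' b' : R) :
    intertwiner s b * upperStep s a' b' = lowerStep s b a' b' * intertwiner s b' := by
  ext x y
  simp only [mul_apply, Fintype.sum_bool]
  simp only [intertwiner, upperStep, upperEdge, lowerStep, lowerSite, lowerEdge, of_apply]
  cases x <;> cases y <;>
    simp only [Bool.false_eq_true, not_true_eq_false, not_false_eq_true, and_true, and_false,
      if_true, if_false] <;>
    ring

theorem vecMul_upperStep (s a b : R) :
    (fun x => if x then s else 1) ᵥ* upperStep s a b =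
      (fun x => (if x then s else 1) * lowerSite a b x) ᵥ* intertwiner s b := by
  ext y
  simp only [vecMul, dotProduct, Fintype.sum_bool]
  simp only [intertwiner, upperStep, upperEdge, lowerSite, of_apply]
  cases y <;>
    simp only [Bool.false_eq_true, not_true_eq_false, not_false_eq_true, and_true, and_false,
      if_true, if_false] <;>
    ring

theorem intertwiner_mulVec_one (s b : R) : intertwiner s b *ᵥ 1 = fun _ => 1 + s := by
  ext x
  simp only [mulVec, dotProduct, Fintype.sum_bool]
  cases x <;>
    simp only [intertwiner, of_apply, Pi.one_apply, Bool.false_eq_true, if_true, if_false] <;>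
    ring

theorem pow_card_eq_mul_prod_succ {n : ℕ} (s : R) (I : Finset (Fin (n + 1))) :
    s ^ #I = (if 0 ∈ I then s else 1) * ∏ i : Fin n, if i.succ ∈ I then s else 1 := by
  rw [← Fin.prod_univ_succ fun i => if i ∈ I then s else 1, prod_ite_mem, univ_inter, prod_const]

theorem pow_card_mul_prod_upperEdge {n : ℕ} (s : R) (a b : Fin n → R) (I : Finset (Fin (n + 1))) :
    s ^ #I * ∏ i : Fin n, upperEdge (a i) (b i) (i.castSucc ∈ I) (i.succ ∈ I) =
      pathWeight (fun x : Bool => if x then s else 1) (fun i => upperStep s (a i) (b i))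
        (fun i => i ∈ I) := by
  rw [pow_card_eq_mul_prod_succ]
  simp only [pathWeight, upperStep, of_apply, prod_mul_distrib, decide_eq_true_eq, mul_assoc]

theorem pow_card_mul_prod_lowerEdge {n : ℕ} (s : R) (a b : Fin (n + 1) → R)
    (J : Finset (Fin (n + 1))) :
    s ^ #J * ((∏ j, lowerSite (a j) (b j) (j ∈ J)) *
        ∏ j : Fin n, lowerEdge (b j.castSucc) (a j.succ) (j.castSucc ∈ J) (j.succ ∈ J)) =
      pathWeight (fun x : Bool => (if x then s else 1) * lowerSite (a 0) (b 0) x)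
        (fun j : Fin n => lowerStep s (b j.castSucc) (a j.succ) (b j.succ)) (fun j => j ∈ J) := by
  rw [pow_card_eq_mul_prod_succ, Fin.prod_univ_succ]
  simp only [pathWeight, lowerStep, of_apply, prod_mul_distrib, decide_eq_true_eq]
  ring

theorem sum_upperEdge_eq_sum_lowerEdge {n : ℕ} (s : R) (a b : Fin (n + 1) → R) :
    ∑ I : Finset (Fin (n + 2)),
        s ^ #I * ∏ i : Fin (n + 1), upperEdge (a i) (b i) (i.castSucc ∈ I) (i.succ ∈ I) =
      (1 + s) * ∑ J : Finset (Fin (n + 1)), s ^ #J * ((∏ j, lowerSite (a j) (b j) (j ∈ J)) *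
        ∏ j : Fin n, lowerEdge (b j.castSucc) (a j.succ) (j.castSucc ∈ J) (j.succ ∈ J)) := by
  simp only [pow_card_mul_prod_upperEdge, pow_card_mul_prod_lowerEdge, sum_finset_eq_sum_bool]
  rw [sum_pathWeight_succ, vecMul_upperStep]
  exact sum_pathWeight_of_intertwining (M := fun i => intertwiner s (b i))
    (fun i => intertwiner_mul_upperStep s _ _ _) (intertwiner_mulVec_one s _) _

end TodaEdges

section QFactorial

theorem qFactorial_add_one (q : ℝ) {n : ℤ} (hn : 0 ≤ n) :
    qFactorial q (n + 1) = (1 - q ^ (n + 1)) * qFactorial q n := by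
  lift n to ℕ using hn
  rw [qFactorial, qFactorial, Int.toNat_natCast_add_one, Int.toNat_natCast, prod_range_succ,
    mul_comm]
  norm_cast

/-- The reciprocal of the `q`-factorial, extended by zero to the negative integers. With this
convention the recursion `qFactorialInv_sub_one` holds for all integers. -/
noncomputable def qFactorialInv (q : ℝ) (n : ℤ) : ℝ :=
  if 0 ≤ n then (qFactorial q n)⁻¹ else 0

theorem qFactorialInv_of_nonneg (q : ℝ) {n : ℤ} (hn : 0 ≤ n) :
    qFactorialInv q n = (qFactorial q n)⁻¹ := if_pos hn

theorem nonneg_of_qFactorialInv_ne_zero {q : ℝ} {n : ℤ} (h : qFactorialInv q n ≠ 0) : 0 ≤ n := by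
  by_contra hn
  exact h (if_neg hn)

theorem qFactorialInv_sub_one {q : ℝ} (hq : ¬IsOfFinOrder q) (n : ℤ) :
    qFactorialInv q (n - 1) = (1 - q ^ n) * qFactorialInv q n := by
  rcases lt_trichotomy n 0 with hn | rfl | hn
  · rw [qFactorialInv, qFactorialInv, if_neg (by omega), if_neg (by omega), mul_zero]
  · simp [qFactorialInv]
  · have hfactor : 1 - q ^ n ≠ 0 := by
      lift n to ℕ using hn.le
      rw [zpow_natCast, sub_ne_zero]
      exact fun h => hq (isOfFinOrder_iff_pow_eq_one.2 ⟨n, by exact_mod_cast hn, h.symm⟩)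
    have hrec := qFactorial_add_one q (Int.sub_nonneg_of_le hn)
    rw [zero_add, sub_add_cancel] at hrec
    rw [qFactorialInv_of_nonneg q (by omega), qFactorialInv_of_nonneg q hn.le, hrec, mul_inv,
      mul_inv_cancel_left₀ hfactor]

theorem qFactorialInv_sub_ite {q : ℝ} (hq : ¬IsOfFinOrder q) (n : ℤ) (c : Prop) [Decidable c] :
    qFactorialInv q (n - if c then 1 else 0) =
      (if c then 1 - q ^ n else 1) * qFactorialInv q n := by
  split_ifs
  · exact qFactorialInv_sub_one hq n
  · rw [sub_zero, one_mul]

theorem qFactorialInv_add_ite {q : ℝ} (hq : ¬IsOfFinOrder q) (n : ℤ) (c : Prop) [Decidable c] :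
    qFactorialInv q (n + if c then 1 else 0) =
      (if c then 1 else 1 - q ^ (n + 1)) * qFactorialInv q (n + 1) := by
  split_ifs
  · rw [one_mul]
  · rw [← qFactorialInv_sub_one hq, add_sub_cancel_right, add_zero]

end QFactorial

section Kernel

/-- The product of the `q`-factorials of the consecutive differences `p_{i+1} - p_i`. -/
noncomputable def gapFactorial {n : ℕ} (q : ℝ) (p : Fin (n + 1) → ℤ) : ℝ :=
  ∏ i : Fin n, qFactorial q (p i.succ - p i.castSucc)

/-- The product of `1 / ((p'_i - p_i)_q! (p_{i+1} - p'_i)_q!)`. It vanishes unless `p'` interlaces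
`p`, a condition which is expressed below by `p' ∈ Icc (Fin.init p) (Fin.tail p)`. -/
noncomputable def interlacingKernel {n : ℕ} (q : ℝ) (p : Fin (n + 1) → ℤ) (p' : Fin n → ℤ) : ℝ :=
  ∏ i, qFactorialInv q (p' i - p i.castSucc) * qFactorialInv q (p i.succ - p' i)

/-- The kernel of the recursion that expresses the function `Ψ` of `p`, with last spectral
parameter `z = q ^ λ_{ℓ+1}`, through the function `Ψ` of the shorter vector `p'`. -/
noncomputable def gzKernel {n : ℕ} (q z : ℝ) (p : Fin (n + 2) → ℤ) (p' : Fin (n + 1) → ℤ) : ℝ :=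
  z ^ (∑ i, p i - ∑ i, p' i) * (interlacingKernel q p p' * gapFactorial q p')

theorem mem_Icc_of_interlacingKernel_ne_zero {n : ℕ} {q : ℝ} {p : Fin (n + 1) → ℤ}
    {p' : Fin n → ℤ} (h : interlacingKernel q p p' ≠ 0) : p' ∈ Icc (Fin.init p) (Fin.tail p) := by
  have hi (i : Fin n) := prod_ne_zero_iff.1 h i (mem_univ i)
  exact mem_Icc.2
    ⟨fun i => sub_nonneg.1 (nonneg_of_qFactorialInv_ne_zero (left_ne_zero_of_mul (hi i))),
      fun i => sub_nonneg.1 (nonneg_of_qFactorialInv_ne_zero (right_ne_zero_of_mul (hi i)))⟩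

theorem mem_Icc_of_gzKernel_ne_zero {n : ℕ} {q z : ℝ} {p : Fin (n + 2) → ℤ}
    {p' : Fin (n + 1) → ℤ} (h : gzKernel q z p p' ≠ 0) : p' ∈ Icc (Fin.init p) (Fin.tail p) :=
  mem_Icc_of_interlacingKernel_ne_zero (left_ne_zero_of_mul (right_ne_zero_of_mul h))

theorem gzKernel_of_mem_Icc {n : ℕ} {q z : ℝ} {p : Fin (n + 2) → ℤ} {p' : Fin (n + 1) → ℤ}
    (h : p' ∈ Icc (Fin.init p) (Fin.tail p)) :
    gzKernel q z p p' = z ^ (∑ i, p i - ∑ i, p' i) * (gapFactorial q p' /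
      ∏ i, qFactorial q (p' i - p i.castSucc) * qFactorial q (p i.succ - p' i)) := by
  rw [gzKernel, interlacingKernel, div_eq_inv_mul, ← prod_inv_distrib]
  congr! 3 with i
  have hleft : 0 ≤ p' i - p i.castSucc := sub_nonneg.2 ((mem_Icc.1 h).1 i)
  have hright : 0 ≤ p i.succ - p' i := sub_nonneg.2 ((mem_Icc.1 h).2 i)
  rw [qFactorialInv_of_nonneg q hleft, qFactorialInv_of_nonneg q hright, mul_inv]

theorem finite_support_gzKernel {n : ℕ} (q z : ℝ) (p : Fin (n + 2) → ℤ) :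
    (Function.support (gzKernel q z p)).Finite :=
  (finite_toSet (Icc (Fin.init p) (Fin.tail p))).subset fun _ h => mem_Icc_of_gzKernel_ne_zero h

theorem monotone_of_mem_Icc_init_tail {n : ℕ} {p : Fin (n + 2) → ℤ} {p' : Fin (n + 1) → ℤ}
    (h : p' ∈ Icc (Fin.init p) (Fin.tail p)) : Monotone p' :=
  Fin.monotone_iff_le_succ.2 fun i => ((mem_Icc.1 h).2 i.castSucc).trans ((mem_Icc.1 h).1 i.succ)

/-- The zero-one vector of `I`, by which `T_I` shifts the argument. -/
def indicatorVec {n : ℕ} (I : Finset (Fin n)) : Fin n → ℤ := fun i => if i ∈ I then 1 else 0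

theorem sum_indicatorVec {n : ℕ} (I : Finset (Fin n)) : ∑ i, indicatorVec I i = #I := by
  simp [indicatorVec]

theorem shift_eq_add_indicatorVec {ℓ : ℕ} (I : Finset (Fin (ℓ + 1)))
    (f : (Fin (ℓ + 1) → ℤ) → ℝ) (p : Fin (ℓ + 1) → ℤ) : shift I f p = f (p + indicatorVec I) :=
  rfl

theorem todaCoeff_eq_prod {ℓ : ℕ} (q : ℝ) (I : Finset (Fin (ℓ + 1))) (p : Fin (ℓ + 1) → ℤ) :
    todaCoeff q I p = ∏ i : Fin ℓ,
      if i.succ ∈ I ∧ i.castSucc ∉ I then 1 - q ^ (p i.succ - p i.castSucc + 1) else 1 := by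
  have hpred (i : Fin ℓ) : (∃ j ∈ I, (j : ℕ) + 1 = (i.succ : ℕ)) ↔ i.castSucc ∈ I := by
    refine ⟨fun ⟨j, hj, hji⟩ => ?_, fun h => ⟨_, h, rfl⟩⟩
    rwa [show i.castSucc = j from Fin.ext (by simpa using hji.symm)]
  have hfirst : todaX q p 0 = 1 := rfl
  have hsucc (i : Fin ℓ) : todaX q p i.succ = 1 - q ^ (p i.succ - p i.castSucc + 1) := rfl
  calc todaCoeff q I p
      = ∏ i, if i ∈ I then if ∃ j ∈ I, (j : ℕ) + 1 = (i : ℕ) then 1 else todaX q p i else 1 := by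
        rw [prod_ite_mem, univ_inter, todaCoeff]
    _ = _ := by
        rw [Fin.prod_univ_succ, hfirst, ite_self, ite_self, one_mul]
        refine prod_congr rfl fun i _ => ?_
        rw [if_congr (hpred i) rfl rfl, hsucc, ite_and, ite_not]

theorem todaCoeff_mul_gapFactorial {n : ℕ} (q : ℝ) {p : Fin (n + 1) → ℤ} {J : Finset (Fin (n + 1))}
    (hp : Monotone p) (hpJ : Monotone (p + indicatorVec J)) :
    todaCoeff q J p * gapFactorial q p = gapFactorial q (p + indicatorVec J) *
      ∏ j : Fin n,
        if j.castSucc ∈ J ∧ j.succ ∉ J then 1 - q ^ (p j.succ - p j.castSucc) else 1 := by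
  rw [todaCoeff_eq_prod, gapFactorial, gapFactorial, ← prod_mul_distrib, ← prod_mul_distrib]
  refine prod_congr rfl fun j _ => ?_
  have hgap : 0 ≤ p j.succ - p j.castSucc := sub_nonneg.2 (hp j.castSucc_lt_succ.le)
  have hgapJ := sub_nonneg.2 (hpJ j.castSucc_lt_succ.le)
  simp only [Pi.add_apply, indicatorVec, add_sub_add_comm] at hgapJ ⊢
  generalize p j.succ - p j.castSucc = d at *
  by_cases hc : j.castSucc ∈ J <;> by_cases hs : j.succ ∈ J <;>
    simp only [hc, hs, if_true, if_false, not_true_eq_false, not_false_eq_true, and_true,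
      and_false, and_self, one_mul, mul_one, sub_self, add_zero, sub_zero] at hgapJ ⊢
  · rw [zero_sub, ← sub_eq_add_neg] at hgapJ ⊢
    have hrec := qFactorial_add_one q hgapJ
    rwa [sub_add_cancel, mul_comm] at hrec
  · rw [qFactorial_add_one q hgap]

/-- The quantity `q ^ (p'_i - p_i)`, by which the kernels at the points neighbouring `(p, p')`
are expressed. -/
noncomputable def leftGapPow {n : ℕ} (q : ℝ) (p : Fin (n + 1) → ℤ) (p' : Fin n → ℤ) (i : Fin n) :
    ℝ :=
  q ^ (p' i - p i.castSucc)

/-- The quantity `q ^ (p_{i+1} - p'_i + 1)`, by which the kernels at the points neighbouring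
`(p, p')` are expressed. -/
noncomputable def rightGapPow {n : ℕ} (q : ℝ) (p : Fin (n + 1) → ℤ) (p' : Fin n → ℤ) (i : Fin n) :
    ℝ :=
  q ^ (p i.succ - p' i + 1)

/-- The common factor of the kernels at `(p + 1_I, p')` and at `(p, p' - 1_J)`. -/
noncomputable def kernelCommonFactor {n : ℕ} (q : ℝ) (p : Fin (n + 1) → ℤ) (p' : Fin n → ℤ) : ℝ :=
  ∏ i, qFactorialInv q (p' i - p i.castSucc) * qFactorialInv q (p i.succ - p' i + 1)

theorem todaCoeff_mul_interlacingKernel_add_indicatorVec {n : ℕ} {q : ℝ} (hq0 : q ≠ 0)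
    (hq : ¬IsOfFinOrder q) (p : Fin (n + 1) → ℤ) (p' : Fin n → ℤ) (I : Finset (Fin (n + 1))) :
    todaCoeff q I p * interlacingKernel q (p + indicatorVec I) p' = kernelCommonFactor q p p' *
      ∏ i, upperEdge (leftGapPow q p p' i) (rightGapPow q p p' i)
        (i.castSucc ∈ I) (i.succ ∈ I) := by
  rw [todaCoeff_eq_prod, interlacingKernel, kernelCommonFactor, ← prod_mul_distrib,
    ← prod_mul_distrib]
  refine prod_congr rfl fun i _ => ?_
  have hexp : p i.succ - p i.castSucc + 1 = p' i - p i.castSucc + (p i.succ - p' i + 1) := by ring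
  simp only [Pi.add_apply, indicatorVec, upperEdge, leftGapPow, rightGapPow, decide_eq_true_eq]
  rw [← sub_sub, add_sub_right_comm, qFactorialInv_sub_ite hq, qFactorialInv_add_ite hq, hexp,
    zpow_add₀ hq0]
  ring

theorem interlacingKernel_sub_indicatorVec {n : ℕ} {q : ℝ} (hq : ¬IsOfFinOrder q)
    (p : Fin (n + 1) → ℤ) (p' : Fin n → ℤ) (J : Finset (Fin n)) :
    interlacingKernel q p (p' - indicatorVec J) = kernelCommonFactor q p p' *
      ∏ j, lowerSite (leftGapPow q p p' j) (rightGapPow q p p' j) (j ∈ J) := by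
  rw [interlacingKernel, kernelCommonFactor, ← prod_mul_distrib]
  refine prod_congr rfl fun j _ => ?_
  simp only [Pi.sub_apply, indicatorVec, lowerSite, leftGapPow, rightGapPow, decide_eq_true_eq]
  rw [sub_right_comm, sub_sub_eq_add_sub, add_sub_right_comm, qFactorialInv_sub_ite hq,
    qFactorialInv_add_ite hq]
  split_ifs <;> ring

theorem interlacingKernel_mul_todaCoeff_mul_gapFactorial {n : ℕ} {q : ℝ} (hq0 : q ≠ 0)
    (hq : ¬IsOfFinOrder q) (p : Fin (n + 2) → ℤ) {p' : Fin (n + 1) → ℤ} (hp' : Monotone p')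
    (J : Finset (Fin (n + 1))) :
    interlacingKernel q p (p' - indicatorVec J) *
        (todaCoeff q J (p' - indicatorVec J) * gapFactorial q (p' - indicatorVec J)) =
      kernelCommonFactor q p p' * gapFactorial q p' *
        ((∏ j, lowerSite (leftGapPow q p p' j) (rightGapPow q p p' j) (j ∈ J)) *
          ∏ j : Fin n, lowerEdge (rightGapPow q p p' j.castSucc) (leftGapPow q p p' j.succ)
            (j.castSucc ∈ J) (j.succ ∈ J)) := by
  have hgap (h : interlacingKernel q p (p' - indicatorVec J) ≠ 0) :
      todaCoeff q J (p' - indicatorVec J) * gapFactorial q (p' - indicatorVec J) =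
        gapFactorial q p' * ∏ j : Fin n, lowerEdge (rightGapPow q p p' j.castSucc)
          (leftGapPow q p p' j.succ) (j.castSucc ∈ J) (j.succ ∈ J) := by
    have hmono := monotone_of_mem_Icc_init_tail (mem_Icc_of_interlacingKernel_ne_zero h)
    rw [todaCoeff_mul_gapFactorial q hmono (by rwa [sub_add_cancel]), sub_add_cancel]
    congr! 2 with j
    simp only [lowerEdge, leftGapPow, rightGapPow, ← zpow_add₀ hq0, decide_eq_true_eq]
    refine if_ctx_congr Iff.rfl (fun hj => ?_) fun _ => rfl
    simp only [Pi.sub_apply, indicatorVec, if_pos hj.1, if_neg hj.2, Fin.succ_castSucc]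
    ring_nf
  calc interlacingKernel q p (p' - indicatorVec J) *
        (todaCoeff q J (p' - indicatorVec J) * gapFactorial q (p' - indicatorVec J))
      = interlacingKernel q p (p' - indicatorVec J) * (gapFactorial q p' * ∏ j : Fin n, lowerEdge
          (rightGapPow q p p' j.castSucc) (leftGapPow q p p' j.succ)
            (j.castSucc ∈ J) (j.succ ∈ J)) := mul_eq_mul_left_iff.2 (or_iff_not_imp_right.2 hgap)
    _ = _ := by
        rw [interlacingKernel_sub_indicatorVec hq]
        ring

theorem todaCoeff_mul_gzKernel_add_indicatorVec {n : ℕ} {q z : ℝ} (hq0 : q ≠ 0)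
    (hq : ¬IsOfFinOrder q) (hz : z ≠ 0) (p : Fin (n + 2) → ℤ) (p' : Fin (n + 1) → ℤ)
    (I : Finset (Fin (n + 2))) :
    todaCoeff q I p * gzKernel q z (p + indicatorVec I) p' =
      z ^ (∑ i, p i - ∑ i, p' i) * kernelCommonFactor q p p' * gapFactorial q p' * (z ^ #I *
        ∏ i, upperEdge (leftGapPow q p p' i) (rightGapPow q p p' i)
          (i.castSucc ∈ I) (i.succ ∈ I)) := by
  have hpow : z ^ (∑ i, (p + indicatorVec I) i - ∑ i, p' i) =
      z ^ (∑ i, p i - ∑ i, p' i) * z ^ #I := by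
    simp only [Pi.add_apply, sum_add_distrib, sum_indicatorVec]
    rw [add_sub_right_comm, zpow_add₀ hz, zpow_natCast]
  rw [gzKernel, hpow, mul_left_comm, ← mul_assoc (todaCoeff q I p),
    todaCoeff_mul_interlacingKernel_add_indicatorVec hq0 hq]
  ring

theorem todaCoeff_mul_gzKernel_sub_indicatorVec {n : ℕ} {q z : ℝ} (hq0 : q ≠ 0)
    (hq : ¬IsOfFinOrder q) (hz : z ≠ 0) (p : Fin (n + 2) → ℤ) {p' : Fin (n + 1) → ℤ}
    (hp' : Monotone p') (J : Finset (Fin (n + 1))) :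
    todaCoeff q J (p' - indicatorVec J) * gzKernel q z p (p' - indicatorVec J) =
      z ^ (∑ i, p i - ∑ i, p' i) * kernelCommonFactor q p p' * gapFactorial q p' * (z ^ #J *
        ((∏ j, lowerSite (leftGapPow q p p' j) (rightGapPow q p p' j) (j ∈ J)) *
          ∏ j : Fin n, lowerEdge (rightGapPow q p p' j.castSucc) (leftGapPow q p p' j.succ)
            (j.castSucc ∈ J) (j.succ ∈ J))) := by
  have hpow : z ^ (∑ i, p i - ∑ i, (p' - indicatorVec J) i) =
      z ^ (∑ i, p i - ∑ i, p' i) * z ^ #J := by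
    simp only [Pi.sub_apply, sum_sub_distrib, sum_indicatorVec]
    rw [sub_sub_eq_add_sub, add_sub_right_comm, zpow_add₀ hz, zpow_natCast]
  rw [gzKernel, hpow, mul_left_comm, mul_left_comm (todaCoeff _ _ _),
    interlacingKernel_mul_todaCoeff_mul_gapFactorial hq0 hq p hp']
  ring

end Kernel

section HamiltonianSeries

variable {n : ℕ} {q t z : ℝ}

/-- The generating function `∑ t ^ r H_r` of the Hamiltonians, applied to `f`. -/
noncomputable def hamiltonianSeries (q t : ℝ) (f : (Fin (n + 1) → ℤ) → ℝ) (p : Fin (n + 1) → ℤ) :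
    ℝ :=
  ∑ I : Finset (Fin (n + 1)), t ^ #I * (todaCoeff q I p * shift I f p)

/-- The formal adjoint of `hamiltonianSeries` for the pairing `∑ p, g p * f p`. -/
noncomputable def hamiltonianSeriesAdjoint (q t : ℝ) (g : (Fin (n + 1) → ℤ) → ℝ)
    (p : Fin (n + 1) → ℤ) : ℝ :=
  ∑ I : Finset (Fin (n + 1)),
    t ^ #I * (todaCoeff q I (p - indicatorVec I) * g (p - indicatorVec I))

theorem finsum_mul_hamiltonianSeries {g : (Fin (n + 1) → ℤ) → ℝ} (hg : g.support.Finite)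
    (f : (Fin (n + 1) → ℤ) → ℝ) :
    ∑ᶠ p, g p * hamiltonianSeries q t f p = ∑ᶠ p, hamiltonianSeriesAdjoint q t g p * f p := by
  have hg' (I : Finset (Fin (n + 1))) : (fun p => g (p - indicatorVec I)).support.Finite :=
    hg.preimage sub_left_injective.injOn
  simp only [hamiltonianSeries, hamiltonianSeriesAdjoint, mul_sum, sum_mul]
  rw [finsum_sum_comm _ _ fun I _ => hg.subset (Function.support_mul_subset_left _ _),
    finsum_sum_comm _ _ fun I _ => (hg' I).subset fun p hp h0 => hp (by simp [h0])]
  refine sum_congr rfl fun I _ => ?_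
  refine .trans (finsum_congr fun p => ?_) (finsum_comp_equiv (Equiv.addRight (indicatorVec I)))
  simp only [Equiv.coe_addRight, add_sub_cancel_right, shift_eq_add_indicatorVec]
  ring

/-- The operator with kernel `gzKernel`, which turns the function `Ψ` of `n + 1` variables into
that of `n + 2` variables. -/
noncomputable def gzTransform (q z : ℝ) (f : (Fin (n + 1) → ℤ) → ℝ) (p : Fin (n + 2) → ℤ) : ℝ :=
  ∑ᶠ p', gzKernel q z p p' * f p'

theorem gzTransform_const_mul (c : ℝ) (f : (Fin (n + 1) → ℤ) → ℝ) (p : Fin (n + 2) → ℤ) :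
    gzTransform q z (fun p' => c * f p') p = c * gzTransform q z f p := by
  simp only [gzTransform, mul_finsum, mul_left_comm]

theorem hamiltonianSeries_gzTransform_eq_finsum (f : (Fin (n + 1) → ℤ) → ℝ)
    (p : Fin (n + 2) → ℤ) :
    hamiltonianSeries q t (gzTransform q z f) p =
      ∑ᶠ p', hamiltonianSeries q t (fun r => gzKernel q z r p') p * f p' := by
  simp only [hamiltonianSeries, sum_mul, shift_eq_add_indicatorVec, gzTransform, mul_finsum]
  rw [finsum_sum_comm]
  · simp only [mul_assoc]
  · exact fun I _ => (finite_support_gzKernel q z (p + indicatorVec I)).subset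
      fun p' hp' h0 => hp' (by simp [h0])

theorem hamiltonianSeries_gzKernel (hq0 : q ≠ 0) (hq : ¬IsOfFinOrder q) (hz : z ≠ 0)
    (p : Fin (n + 2) → ℤ) {p' : Fin (n + 1) → ℤ} (hp' : Monotone p') :
    hamiltonianSeries q t (fun r => gzKernel q z r p') p =
      (1 + t * z) * hamiltonianSeriesAdjoint q t (gzKernel q z p) p' := by
  have hpow (k : ℕ) (c x : ℝ) : t ^ k * (c * (z ^ k * x)) = c * ((t * z) ^ k * x) := by
    rw [mul_pow]
    ring
  simp only [hamiltonianSeries, hamiltonianSeriesAdjoint, shift_eq_add_indicatorVec,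
    todaCoeff_mul_gzKernel_add_indicatorVec hq0 hq hz,
    todaCoeff_mul_gzKernel_sub_indicatorVec hq0 hq hz p hp', hpow, ← mul_sum]
  rw [sum_upperEdge_eq_sum_lowerEdge, mul_left_comm]

theorem hamiltonianSeries_gzTransform (hq0 : q ≠ 0) (hq : ¬IsOfFinOrder q) (hz : z ≠ 0)
    {f : (Fin (n + 1) → ℤ) → ℝ} (hf : ∀ p', ¬Monotone p' → f p' = 0) (p : Fin (n + 2) → ℤ) :
    hamiltonianSeries q t (gzTransform q z f) p =
      (1 + t * z) * gzTransform q z (hamiltonianSeries q t f) p := by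
  rw [hamiltonianSeries_gzTransform_eq_finsum, gzTransform,
    finsum_mul_hamiltonianSeries (finite_support_gzKernel q z p), mul_finsum]
  refine finsum_congr fun p' => ?_
  by_cases hp' : Monotone p'
  · rw [hamiltonianSeries_gzKernel hq0 hq hz p hp', mul_assoc]
  · simp [hf p' hp']

end HamiltonianSeries

section Recursion

variable {ℓ : ℕ} {q : ℝ}

/-- The array without its top row. -/
def dropRow (P : TriangularArray (ℓ + 1)) : TriangularArray ℓ := fun k => P k.castSucc

/-- The array with `p` as an additional top row. -/
def addRow (P : TriangularArray ℓ) (p : Fin (ℓ + 2) → ℤ) : TriangularArray (ℓ + 1) :=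
  Fin.snoc (α := fun k : Fin (ℓ + 2) => Fin ((k : ℕ) + 1) → ℤ) P p

theorem addRow_last (P : TriangularArray ℓ) (p : Fin (ℓ + 2) → ℤ) :
    addRow P p (Fin.last (ℓ + 1)) = p :=
  Fin.snoc_last (α := fun k : Fin (ℓ + 2) => Fin ((k : ℕ) + 1) → ℤ) p P

theorem dropRow_addRow (P : TriangularArray ℓ) (p : Fin (ℓ + 2) → ℤ) : dropRow (addRow P p) = P :=
  funext (Fin.snoc_castSucc (α := fun k : Fin (ℓ + 2) => Fin ((k : ℕ) + 1) → ℤ) p P)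

theorem addRow_dropRow (P : TriangularArray (ℓ + 1)) : addRow (dropRow P) (P (Fin.last _)) = P :=
  Fin.snoc_init_self (α := fun k : Fin (ℓ + 2) => Fin ((k : ℕ) + 1) → ℤ) P

theorem mem_gzPatterns_succ_iff {p : Fin (ℓ + 2) → ℤ} {P : TriangularArray (ℓ + 1)} :
    P ∈ gzPatterns p ↔ P (Fin.last _) = p ∧
      dropRow P (Fin.last ℓ) ∈ Icc (Fin.init p) (Fin.tail p) ∧
        dropRow P ∈ gzPatterns (dropRow P (Fin.last ℓ)) := by
  constructor
  · rintro ⟨rfl, h⟩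
    exact ⟨rfl, mem_Icc.2 ⟨fun j => (h (Fin.last ℓ) j).1, fun j => (h (Fin.last ℓ) j).2⟩, rfl,
      fun k => h k.castSucc⟩
  · rintro ⟨rfl, htop, -, h⟩
    exact ⟨rfl, Fin.lastCases (fun j => ⟨(mem_Icc.1 htop).1 j, (mem_Icc.1 htop).2 j⟩) h⟩

theorem gzPatterns_zero (p : Fin 1 → ℤ) : gzPatterns p = {fun _ _ => p 0} := by
  ext P
  rw [Set.mem_singleton_iff]
  constructor
  · rintro ⟨rfl, -⟩
    funext k i
    obtain rfl := Subsingleton.elim (α := Fin 1) k (Fin.last 0)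
    exact congrArg (P (Fin.last 0)) (Subsingleton.elim (α := Fin 1) i 0)
  · rintro rfl
    exact ⟨funext fun i => congrArg p (Subsingleton.elim (α := Fin 1) 0 i), fun k => k.elim0⟩

theorem monotone_of_mem_gzPatterns {p : Fin (ℓ + 1) → ℤ} {P : TriangularArray ℓ}
    (hP : P ∈ gzPatterns p) : Monotone p := by
  obtain ⟨rfl, h⟩ := hP
  cases ℓ with
  | zero => exact Subsingleton.monotone (α := Fin 1) _
  | succ ℓ =>
    exact Fin.monotone_iff_le_succ.2 fun i => (h (Fin.last ℓ) i).1.trans (h (Fin.last ℓ) i).2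

theorem qWhittaker_of_not_monotone (q : ℝ) (lam : Fin (ℓ + 1) → ℝ) {p : Fin (ℓ + 1) → ℤ}
    (hp : ¬Monotone p) : qWhittaker q lam p = 0 := if_neg hp

theorem qWhittaker_eq_sum (q : ℝ) (lam : Fin (ℓ + 1) → ℝ) (p : Fin (ℓ + 1) → ℤ) :
    qWhittaker q lam p = ∑ P ∈ (gzPatterns_finite p).toFinset, gzWeight q lam P := by
  rw [qWhittaker, ite_eq_left_iff]
  refine fun hp => (sum_eq_zero fun P hP => absurd ?_ hp).symm
  exact monotone_of_mem_gzPatterns ((gzPatterns_finite p).mem_toFinset.1 hP)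

theorem qWhittaker_zero (hq : 0 < q) (lam : Fin 1 → ℝ) (p : Fin 1 → ℤ) :
    qWhittaker q lam p = (q ^ lam 0) ^ p 0 := by
  have hpatterns : (gzPatterns_finite p).toFinset = {fun _ _ => p 0} := by
    rw [← coe_inj, Set.Finite.coe_toFinset, coe_singleton, gzPatterns_zero]
  rw [qWhittaker_eq_sum, hpatterns, sum_singleton, ← Real.rpow_intCast, ← Real.rpow_mul hq.le]
  simp [gzWeight, prevRowSum]

theorem prevRowSum_castSucc (P : TriangularArray (ℓ + 1)) (k : Fin (ℓ + 1)) :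
    prevRowSum P k.castSucc = prevRowSum (dropRow P) k := by
  cases k using Fin.cases <;> rfl

theorem gzWeight_succ (hq : 0 < q) (lam : Fin (ℓ + 2) → ℝ) {P : TriangularArray (ℓ + 1)}
    (hP : dropRow P (Fin.last ℓ) ∈ Icc (Fin.init (P (Fin.last _))) (Fin.tail (P (Fin.last _)))) :
    gzWeight q lam P = gzKernel q (q ^ lam (Fin.last _)) (P (Fin.last _)) (dropRow P (Fin.last ℓ)) *
      gzWeight q (Fin.init lam) (dropRow P) := by
  have htop : q ^ (lam (Fin.last _) *
      (((∑ i, P (Fin.last _) i) - prevRowSum P (Fin.last _) : ℤ) : ℝ)) =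
      (q ^ lam (Fin.last _)) ^ ((∑ i, P (Fin.last _) i) - ∑ i, dropRow P (Fin.last ℓ) i) := by
    rw [Real.rpow_mul hq.le, Real.rpow_intCast]
    rfl
  rw [gzKernel_of_mem_Icc hP, gzWeight, Fin.prod_univ_castSucc (n := ℓ + 1),
    Fin.prod_univ_castSucc fun k : Fin (ℓ + 1) => ∏ i : Fin (k : ℕ), _,
    Fin.prod_univ_castSucc fun k : Fin (ℓ + 1) => ∏ i : Fin ((k : ℕ) + 1), _, htop,
    mul_div_mul_comm, mul_mul_mul_comm, mul_comm]
  simp only [prevRowSum_castSucc]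
  rfl

theorem qWhittaker_succ (hq : 0 < q) (lam : Fin (ℓ + 2) → ℝ) (p : Fin (ℓ + 2) → ℤ) :
    qWhittaker q lam p = gzTransform q (q ^ lam (Fin.last _)) (qWhittaker q (Fin.init lam)) p := by
  rw [gzTransform, finsum_eq_sum_of_support_subset (s := Icc (Fin.init p) (Fin.tail p)) _
    fun p' h => mem_Icc_of_gzKernel_ne_zero (left_ne_zero_of_mul h)]
  simp only [qWhittaker_eq_sum, mul_sum]
  rw [sum_sigma']
  refine sum_bij' (fun P _ => ⟨dropRow P (Fin.last ℓ), dropRow P⟩) (fun x _ => addRow x.2 p)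
    ?_ ?_ ?_ ?_ ?_
  · intro P hP
    rw [Set.Finite.mem_toFinset, mem_gzPatterns_succ_iff] at hP
    simpa only [mem_sigma, Set.Finite.mem_toFinset] using hP.2
  · rintro ⟨p', P⟩ h
    simp only [mem_sigma, Set.Finite.mem_toFinset] at h ⊢
    obtain ⟨hp', rfl, hP⟩ := h
    rw [mem_gzPatterns_succ_iff, addRow_last, dropRow_addRow]
    exact ⟨rfl, hp', rfl, hP⟩
  · intro P hP
    obtain rfl := ((gzPatterns_finite p).mem_toFinset.1 hP).1
    exact addRow_dropRow P
  · rintro ⟨p', P⟩ h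
    simp only [mem_sigma, Set.Finite.mem_toFinset] at h
    obtain ⟨-, rfl, -⟩ := h
    simp only [dropRow_addRow]
  · intro P hP
    rw [Set.Finite.mem_toFinset, mem_gzPatterns_succ_iff] at hP
    obtain ⟨rfl, hmem, -⟩ := hP
    exact gzWeight_succ hq lam hmem

theorem hamiltonianSeries_qWhittaker (hq0 : 0 < q) (hq : ¬IsOfFinOrder q) (t : ℝ)
    (lam : Fin (ℓ + 1) → ℝ) (p : Fin (ℓ + 1) → ℤ) :
    hamiltonianSeries q t (qWhittaker q lam) p =
      (∏ i, (1 + t * q ^ lam i)) * qWhittaker q lam p := by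
  induction ℓ with
  | zero =>
    have hz : q ^ lam 0 ≠ 0 := (Real.rpow_pos_of_pos hq0 _).ne'
    simp only [hamiltonianSeries, shift_eq_add_indicatorVec, qWhittaker_zero hq0]
    rw [show (univ : Finset (Finset (Fin 1))) = {∅, {0}} by decide,
      sum_pair (singleton_ne_empty _).symm]
    simp only [todaCoeff_eq_prod, indicatorVec, Pi.add_apply, univ_eq_empty, prod_empty,
      Fin.prod_univ_succ, card_empty, card_singleton, notMem_empty, mem_singleton, if_true,
      if_false, pow_zero, pow_one, add_zero, zpow_add_one₀ hz]
    ring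
  | succ ℓ ih =>
    have hz : q ^ lam (Fin.last _) ≠ 0 := (Real.rpow_pos_of_pos hq0 _).ne'
    rw [funext (qWhittaker_succ hq0 lam),
      hamiltonianSeries_gzTransform hq0.ne' hq hz (fun _ => qWhittaker_of_not_monotone q _),
      funext (ih (Fin.init lam)), gzTransform_const_mul, Fin.prod_univ_castSucc (n := ℓ + 1),
      ← mul_assoc, mul_comm (1 + _)]
    rfl

theorem qWhittaker_apply_zero (hq : 0 < q) (lam : Fin (ℓ + 1) → ℝ) : qWhittaker q lam 0 = 1 := by
  induction ℓ with
  | zero => rw [qWhittaker_zero hq, Pi.zero_apply, zpow_zero]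
  | succ ℓ ih =>
    rw [qWhittaker_succ hq, gzTransform, finsum_eq_single _ 0, ih, mul_one]
    · simp [gzKernel, interlacingKernel, gapFactorial, qFactorialInv, qFactorial]
    · intro p' hp'
      contrapose! hp'
      have hmem := mem_Icc.1 (mem_Icc_of_gzKernel_ne_zero (left_ne_zero_of_mul hp'))
      exact le_antisymm hmem.2 hmem.1

end Recursion

end QToda

theorem mainTheorem1_general (ℓ : ℕ) (q : ℝ) (hq0 : 0 < q) (hq1 : q ≠ 1)
    (lam : Fin (ℓ + 1) → ℝ) :
    (∃ p : Fin (ℓ + 1) → ℤ, QToda.qWhittaker q lam p ≠ 0) ∧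
    ∀ (r : ℕ) (p : Fin (ℓ + 1) → ℤ),
      QToda.todaHamiltonian q r (QToda.qWhittaker q lam) p =
        (∑ I ∈ Finset.powersetCard r (Finset.univ : Finset (Fin (ℓ + 1))),
          ∏ i ∈ I, q ^ lam i) * QToda.qWhittaker q lam p := by
  have hq : ¬IsOfFinOrder q := by
    rw [isOfFinOrder_iff_pow_eq_one]
    rintro ⟨n, hn, h⟩
    exact hq1 ((pow_eq_one_iff_of_nonneg hq0.le hn.ne').1 h)
  refine ⟨⟨0, by simp [QToda.qWhittaker_apply_zero hq0]⟩, fun r p => ?_⟩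
  rw [Finset.sum_mul]
  refine QToda.sum_powersetCard_eq_of_sum_pow_card_mul_eq (fun t => ?_) r
  refine (QToda.hamiltonianSeries_qWhittaker hq0 hq t lam p).trans ?_
  simp only [Finset.prod_one_add, Finset.powerset_univ, Finset.prod_mul_distrib,
    Finset.prod_const, Finset.sum_mul, mul_assoc]

/-- For `0 < q < 1` and real `λ_1, ..., λ_{ℓ+1}`, the function `Ψ_λ` is a common eigenfunction of
all the lattice Hamiltonians `H_r`, `1 ≤ r ≤ ℓ + 1`, and the eigenvalue of `H_r` is the `r`-th
elementary symmetric function of the numbers `q^{λ_i}`. -/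
theorem mainTheorem1 (ℓ : ℕ) (q : ℝ) (hq0 : 0 < q) (hq1 : q < 1) (lam : Fin (ℓ + 1) → ℝ) :
    (∃ p : Fin (ℓ + 1) → ℤ, QToda.qWhittaker q lam p ≠ 0) ∧
    ∀ r : ℕ, 1 ≤ r → r ≤ ℓ + 1 → ∀ p : Fin (ℓ + 1) → ℤ,
      QToda.todaHamiltonian q r (QToda.qWhittaker q lam) p =
        (∑ I ∈ Finset.powersetCard r (Finset.univ : Finset (Fin (ℓ + 1))),
          ∏ i ∈ I, q ^ lam i) * QToda.qWhittaker q lam p :=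
  (mainTheorem1_general ℓ q hq0 hq1.ne lam).imp_right fun h r _ _ => h r
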